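/- Let $\Sigma$ be a connected smooth surface, let $f:\Sigma\to\mathbb{R}^3$ be a smooth immersion with smooth Gauss map $N:\Sigma\to S^2$ (so $N\cdot \mathrm{d}f=0$), and let $\mathrm{II}=-\mathrm{d}f\cdot \mathrm{d}N$ be its second fundamental form. Let $S=-(\mathrm{d}f)^{-1}\circ \mathrm{d}N$ be its shape operator and let $K=\det S$, the product of the principal curvatures, be its Gauss curvature. Suppose that $K<0$ everywhere, so that $\mathrm{II}$ is a pseudo-Riemannian metric of signature $(1,1)$ on $\Sigma$. Then the following are equivalent: (a) $K$ is constant. (b) $N:(\Sigma,\mathrm{II})\to S^2$ is a harmonic map, i.e. its tension field $\operatorname{tr}_{\mathrm{II}}\nabla \mathrm{d}N$ vanishes. In local coordinates this says that the component tangent to $S^2$ of $\sum_{i,j}\mathrm{II}^{ij}\bigl(\partial_i\partial_j N-\sum_k\Gamma^k_{ij}\,\partial_k N\bigr)$ vanishes, where $(\mathrm{II}^{ij})$ is the inverse of the coefficient matrix of $\mathrm{II}$ and $\Gamma^k_{ij}$ are the Christoffel symbols of the Levi-Civita connection of $\mathrm{II}$. (c) Every point of $\Sigma$ has a neighbourhood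 with Tchebyshev coordinates for $f$, i.e. smooth coordinates $(\xi,\eta)$ that are asymptotic, $N_\xi\cdot f_\xi=0=N_\eta\cdot f_\eta$, and satisfy $\Vert f_\xi\Vert=1=\Vert f_\eta\Vert$. -/

import Mathlib

open scoped Manifold ContDiff

noncomputable section

namespace KSurface

/-- The Euclidean plane, the model space of surfaces. -/
abbrev E2 : Type := EuclideanSpace ℝ (Fin 2)

/-- Euclidean three-space. -/
abbrev E3 : Type := EuclideanSpace ℝ (Fin 3)

/-- The unit sphere in Euclidean three-space. -/
abbrev S2 : Type := Metric.sphere (0 : E3) 1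

/-! ### Immersed surfaces, their Gauss maps and fundamental forms -/

section Surface

variable {M : Type*} [TopologicalSpace M] [ChartedSpace E2 M]

/-- The differential at `p` of a map from a surface to Euclidean three-space. -/
def diffAt (f : M → E3) (p : M) : TangentSpace (𝓡 2) p →L[ℝ] E3 :=
  mfderiv (𝓡 2) 𝓘(ℝ, E3) f p

/-- `f` is a smooth immersion. -/
structure IsSmoothImmersion (f : M → E3) : Prop where
  smooth : ContMDiff (𝓡 2) 𝓘(ℝ, E3) ∞ f
  injective : ∀ p, Function.Injective (diffAt f p)

/-- A map to the unit sphere, regarded as a map to Euclidean three-space. -/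
def toE3 (N : M → S2) : M → E3 := fun p => (N p : E3)

/-- `N` is a Gauss map of `f`: a smooth unit vector field along `f` with `N · df = 0`. -/
structure IsGaussMap (f : M → E3) (N : M → S2) : Prop where
  smooth : ContMDiff (𝓡 2) 𝓘(ℝ, E3) ∞ (toE3 N)
  normal : ∀ p (v : TangentSpace (𝓡 2) p), inner ℝ (toE3 N p) (diffAt f p v) = 0

/-- The second fundamental form `II = - df · dN`. -/
def secondForm (f : M → E3) (N : M → S2) (p : M) (v w : TangentSpace (𝓡 2) p) : ℝ :=
  - inner ℝ (diffAt f p v) (diffAt (toE3 N) p w)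

open Classical in
/-- The shape operator `S = - (df)⁻¹ ∘ dN`, i.e. the endomorphism of the tangent plane with
`df ∘ S = - dN`. It exists and is unique for an immersion with its Gauss map; the value `0` is
used when there is no such endomorphism. -/
def shapeOperator (f : M → E3) (N : M → S2) (p : M) :
    TangentSpace (𝓡 2) p →ₗ[ℝ] TangentSpace (𝓡 2) p :=
  if h : ∃ S : TangentSpace (𝓡 2) p →ₗ[ℝ] TangentSpace (𝓡 2) p,
      ∀ v, diffAt f p (S v) = - diffAt (toE3 N) p v
  then h.choose else 0

/-- The Gauss curvature `K = κ₁ κ₂`, the product of the two eigenvalues of the shape operator,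
i.e. its determinant. -/
def gaussCurvature (f : M → E3) (N : M → S2) (p : M) : ℝ :=
  LinearMap.det (shapeOperator f N p)

theorem inner_toE3_diffAt {f : M → E3} {N : M → S2} (hN : IsGaussMap f N) (p : M)
    (v : TangentSpace (𝓡 2) p) : inner ℝ (toE3 N p) (diffAt (toE3 N) p v) = 0 := by
  have hd : MDifferentiableAt (𝓡 2) 𝓘(ℝ, E3) (toE3 N) p :=
    (hN.smooth p).mdifferentiableAt (by simp)
  have hin : HasFDerivAt (fun y : E3 => inner ℝ y y) _ (toE3 N p) :=
    (hasFDerivAt_id (toE3 N p)).inner ℝ (hasFDerivAt_id (toE3 N p))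
  have hc := hin.hasMFDerivAt.comp p hd.hasMFDerivAt
  have he : ((fun y : E3 => inner ℝ y y) ∘ toE3 N) = fun _ => (1 : ℝ) := by
    funext q
    have : ‖toE3 N q‖ = 1 := by simp [toE3]
    simp [this]
  rw [he] at hc
  have h0 := hasMFDerivAt_unique hc (hasMFDerivAt_const (1 : ℝ) p)
  have h1 := congrArg (fun L => L v) h0
  have h2 : inner ℝ (toE3 N p) (diffAt (toE3 N) p v)
      + inner ℝ (diffAt (toE3 N) p v) (toE3 N p) = 0 := by
    exact h1
  rw [real_inner_comm (toE3 N p)] at h2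
  linarith

theorem diffAt_shapeOperator {f : M → E3} {N : M → S2} (hf : IsSmoothImmersion f)
    (hN : IsGaussMap f N) (p : M) (v : TangentSpace (𝓡 2) p) :
    diffAt f p (shapeOperator f N p v) = - diffAt (toE3 N) p v := by
  have hex : ∃ S : TangentSpace (𝓡 2) p →ₗ[ℝ] TangentSpace (𝓡 2) p,
      ∀ v, diffAt f p (S v) = - diffAt (toE3 N) p v := by
    have hn : toE3 N p ≠ 0 := by
      intro h
      have : ‖toE3 N p‖ = 1 := by simp [toE3]
      simp [h] at this
    let D : E2 →ₗ[ℝ] E3 := (diffAt f p).toLinearMap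
    have hinj : Function.Injective D := hf.injective p
    have hr : LinearMap.range D = (ℝ ∙ toE3 N p)ᗮ := by
      apply Submodule.eq_of_le_of_finrank_eq
      · rintro _ ⟨w, rfl⟩
        rw [Submodule.mem_orthogonal_singleton_iff_inner_right]
        exact hN.normal p w
      · rw [LinearMap.finrank_range_of_inj hinj]
        have h3 := Submodule.finrank_add_finrank_orthogonal (ℝ ∙ toE3 N p)
        rw [finrank_span_singleton hn] at h3
        simp at h3 ⊢
        omega
    let B : E2 →ₗ[ℝ] E3 := (diffAt (toE3 N) p).toLinearMap
    have hB : ∀ w, B w ∈ LinearMap.range D := fun w => by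
      rw [hr, Submodule.mem_orthogonal_singleton_iff_inner_right]
      exact inner_toE3_diffAt hN p w
    refine ⟨-((LinearEquiv.ofInjective D hinj).symm.toLinearMap ∘ₗ B.codRestrict _ hB),
      fun w => ?_⟩
    have := congrArg Subtype.val
      ((LinearEquiv.ofInjective D hinj).apply_symm_apply (B.codRestrict _ hB w))
    change D (-((LinearEquiv.ofInjective D hinj).symm (B.codRestrict _ hB w))) = - B w
    rw [map_neg]
    exact congrArg Neg.neg this
  unfold shapeOperator
  rw [dif_pos hex]
  exact hex.choose_spec v

end Surface

/-! ### Local coordinates and harmonic maps to the sphere -/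

section Coordinates

/-- The partial derivative in the `i`-th coordinate direction of the plane. -/
def pd {F : Type*} [NormedAddCommGroup F] [NormedSpace ℝ F] (i : Fin 2) (u : E2 → F) (x : E2) :
    F :=
  fderiv ℝ u x (EuclideanSpace.single i 1)

/-- The Christoffel symbols `Γᵏᵢⱼ` of the Levi-Civita connection of the (pseudo-)Riemannian metric
with coefficient matrix `G`. -/
def christoffel (G : E2 → Matrix (Fin 2) (Fin 2) ℝ) (k i j : Fin 2) (x : E2) : ℝ :=
  (1 / 2) * ∑ l, (G x)⁻¹ k l *
    (pd i (fun y => G y j l) x + pd j (fun y => G y i l) x - pd l (fun y => G y i j) x)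

/-- The trace `∑ Gⁱʲ (∂ᵢ ∂ⱼ u - Γᵏᵢⱼ ∂ₖ u)` of the Hessian of a vector-valued function `u`, with
respect to the metric with coefficient matrix `G`. -/
def traceHessian (G : E2 → Matrix (Fin 2) (Fin 2) ℝ) (u : E2 → E3) (x : E2) : E3 :=
  ∑ i, ∑ j, (G x)⁻¹ i j • (pd i (pd j u) x - ∑ k, christoffel G k i j x • pd k u x)

variable {M : Type*} [TopologicalSpace M] [ChartedSpace E2 M]

/-- The coefficient matrix, in the coordinates given by the chart `e`, of a field `g` of bilinear
forms on the tangent planes. -/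
def coordMatrix (g : ∀ p : M, TangentSpace (𝓡 2) p → TangentSpace (𝓡 2) p → ℝ)
    (e : OpenPartialHomeomorph M E2) (x : E2) : Matrix (Fin 2) (Fin 2) ℝ :=
  Matrix.of fun i j =>
    g (e.symm x) (mfderiv 𝓘(ℝ, E2) (𝓡 2) e.symm x (EuclideanSpace.single i 1))
      (mfderiv 𝓘(ℝ, E2) (𝓡 2) e.symm x (EuclideanSpace.single j 1))

/-- The tension field `tr_g ∇dφ` of a map `φ` from a surface with (pseudo-)Riemannian metric `g` to
the unit sphere, at the point with coordinates `x` in the chart `e`. As the Levi-Civita connection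
of the sphere is the tangential part of the flat connection of the ambient space, it is the
tangential part of the trace of the Hessian of the vector-valued function `φ`. -/
def tension (g : ∀ p : M, TangentSpace (𝓡 2) p → TangentSpace (𝓡 2) p → ℝ) (φ : M → S2)
    (e : OpenPartialHomeomorph M E2) (x : E2) : E3 :=
  traceHessian (coordMatrix g e) (toE3 φ ∘ e.symm) x
    - inner ℝ (toE3 φ (e.symm x)) (traceHessian (coordMatrix g e) (toE3 φ ∘ e.symm) x)
      • toE3 φ (e.symm x)

/-- The map `φ : (M, g) → S²` is harmonic: its tension field vanishes (in all smooth charts). -/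
def IsHarmonic (g : ∀ p : M, TangentSpace (𝓡 2) p → TangentSpace (𝓡 2) p → ℝ) (φ : M → S2) :
    Prop :=
  ∀ e ∈ IsManifold.maximalAtlas (𝓡 2) ∞ M, ∀ x ∈ e.target, tension g φ e x = 0

/-- The coordinates `(ξ, η)` given by the chart `e` are asymptotic for `f`:
`N_ξ · f_ξ = 0 = N_η · f_η`. -/
def IsAsymptotic (f : M → E3) (N : M → S2) (e : OpenPartialHomeomorph M E2) : Prop :=
  ∀ x ∈ e.target, ∀ i : Fin 2,
    inner ℝ (pd i (toE3 N ∘ e.symm) x) (pd i (f ∘ e.symm) x) = 0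

/-- The coordinates `(ξ, η)` given by the chart `e` are Tchebyshev for `f`: they are asymptotic and
`‖f_ξ‖ = 1 = ‖f_η‖`. -/
def IsTchebyshev (f : M → E3) (N : M → S2) (e : OpenPartialHomeomorph M E2) : Prop :=
  IsAsymptotic f N e ∧ ∀ x ∈ e.target, ∀ i : Fin 2, ‖pd i (f ∘ e.symm) x‖ = 1

end Coordinates

end KSurface

end


/-!
The Levi-Civita connection of `II` is the average of the Levi-Civita connections of the first and
the third fundamental form `df · df` and `dN · dN`. Hence the tangential part of the `II`-Hessian of
`N` is half of the cubic form `II((∇ᴵ - ∇ᴵᴵᴵ)·, ·)`, which is totally symmetric by the Codazzi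
equations. As `K` is the ratio of the area densities of the third and the first fundamental form,
the `II`-trace of this cubic form is `-d log |K|`, so that the tangential part of `tr_II ∇dN`
vanishes exactly where `dK` does.

In Tchebyshev coordinates `f_ξη` is normal to the surface, so that the mixed components of the cubic
form vanish, and so do the diagonal coefficients of `II`; this makes its `II`-trace, and with it
`dK`, vanish. Conversely, if `r² K = -1`, the one-forms `(df ± r N × dN) / 2` have rank one, and
their exterior derivatives are normal to the surface. So each is a unit vector field times a closed
scalar one-form, and potentials of the two closed forms are Tchebyshev coordinates.
-/

noncomputable section

namespace KSurface

open Matrix Filter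
open scoped RealInnerProductSpace

/-! ### Partial derivatives -/

section PartialDerivatives

variable {H : Type*} [NormedAddCommGroup H] [NormedSpace ℝ H] {U : Set E2} {u v : E2 → H} {x : E2}

theorem pd_congr (h : u =ᶠ[nhds x] v) (i : Fin 2) : pd i u x = pd i v x := by
  rw [pd, pd, h.fderiv_eq]

theorem pd_congr_of_eqOn (hU : IsOpen U) (h : U.EqOn u v) (hx : x ∈ U) (i : Fin 2) :
    pd i u x = pd i v x :=
  pd_congr (h.eventuallyEq_of_mem (hU.mem_nhds hx)) i

theorem contDiffOn_pd (hU : IsOpen U) (hu : ContDiffOn ℝ ∞ u U) (i : Fin 2) :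
    ContDiffOn ℝ ∞ (pd i u) U :=
  (hu.fderiv_of_isOpen hU (by simp)).clm_apply contDiffOn_const

theorem differentiableAt_of_contDiffOn (hU : IsOpen U) (hu : ContDiffOn ℝ ∞ u U) (hx : x ∈ U) :
    DifferentiableAt ℝ u x :=
  (hu.contDiffAt (hU.mem_nhds hx)).differentiableAt (by simp)

theorem differentiableAt_pd (hU : IsOpen U) (hu : ContDiffOn ℝ ∞ u U) (hx : x ∈ U) (i : Fin 2) :
    DifferentiableAt ℝ (pd i u) x :=
  differentiableAt_of_contDiffOn hU (contDiffOn_pd hU hu i) hx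

theorem pd_clm_apply {θ : E2 → E2 →L[ℝ] H} (hθ : DifferentiableAt ℝ θ x) (i : Fin 2) (v : E2) :
    pd i (fun y => θ y v) x = fderiv ℝ θ x (EuclideanSpace.single i 1) v := by
  simp [pd, fderiv_clm_apply hθ (differentiableAt_const _)]

theorem pd_comm (hU : IsOpen U) (hu : ContDiffOn ℝ ∞ u U) (hx : x ∈ U) (i j : Fin 2) :
    pd i (pd j u) x = pd j (pd i u) x := by
  have hd : DifferentiableAt ℝ (fderiv ℝ u) x :=
    differentiableAt_of_contDiffOn hU (hu.fderiv_of_isOpen hU (by simp)) hx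
  have hs : IsSymmSndFDerivAt ℝ u x :=
    (hu.contDiffAt (hU.mem_nhds hx)).isSymmSndFDerivAt
      (by simpa using WithTop.coe_le_coe.2 (le_top : (2 : ℕ∞) ≤ ⊤))
  exact (pd_clm_apply hd i _).trans ((hs.eq _ _).trans (pd_clm_apply hd j _).symm)

theorem pd_const (c : H) (i : Fin 2) (x : E2) : pd i (fun _ => c) x = 0 := by
  simp [pd]

theorem pd_add (hu : DifferentiableAt ℝ u x) (hv : DifferentiableAt ℝ v x) (i : Fin 2) :
    pd i (fun y => u y + v y) x = pd i u x + pd i v x := by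
  simp [pd, fderiv_fun_add hu hv]

theorem pd_neg (u : E2 → H) (i : Fin 2) (x : E2) : pd i (fun y => -u y) x = -pd i u x := by
  simp [pd, fderiv_fun_neg]

theorem pd_const_smul (hu : DifferentiableAt ℝ u x) (c : ℝ) (i : Fin 2) :
    pd i (fun y => c • u y) x = c • pd i u x := by
  simp [pd, fderiv_fun_const_smul hu]

theorem pd_mul {a b : E2 → ℝ} (ha : DifferentiableAt ℝ a x) (hb : DifferentiableAt ℝ b x)
    (i : Fin 2) : pd i (fun y => a y * b y) x = a x * pd i b x + pd i a x * b x := by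
  simp [pd, fderiv_fun_mul ha hb, mul_comm (b x)]

theorem clm_ext {L L' : E2 →L[ℝ] H}
    (h : ∀ i, L (EuclideanSpace.single i 1) = L' (EuclideanSpace.single i 1)) : L = L' :=
  ContinuousLinearMap.coe_injective
    ((EuclideanSpace.basisFun (Fin 2) ℝ).toBasis.ext fun i => by simpa using h i)

end PartialDerivatives

section Inner

variable {H : Type*} [NormedAddCommGroup H] [InnerProductSpace ℝ H] {U : Set E2} {u v : E2 → H}
  {x : E2}

theorem pd_inner (hu : DifferentiableAt ℝ u x) (hv : DifferentiableAt ℝ v x) (i : Fin 2) :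
    pd i (fun y => ⟪u y, v y⟫) x = ⟪u x, pd i v x⟫ + ⟪pd i u x, v x⟫ :=
  fderiv_inner_apply ℝ hu hv _

theorem inner_pd_add_inner_pd_of_inner_eq_const (hU : IsOpen U) (hu : ContDiffOn ℝ ∞ u U)
    (hv : ContDiffOn ℝ ∞ v U) {c : ℝ} (h : ∀ y ∈ U, ⟪u y, v y⟫ = c) (hx : x ∈ U) (i : Fin 2) :
    ⟪u x, pd i v x⟫ + ⟪pd i u x, v x⟫ = 0 := by
  rw [← pd_inner (differentiableAt_of_contDiffOn hU hu hx)
    (differentiableAt_of_contDiffOn hU hv hx), pd_congr_of_eqOn hU h hx, pd_const]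

theorem inner_pd_self_of_norm_eq_one (hU : IsOpen U) (hu : ContDiffOn ℝ ∞ u U)
    (h : ∀ y ∈ U, ‖u y‖ = 1) (hx : x ∈ U) (i : Fin 2) : ⟪u x, pd i u x⟫ = 0 := by
  have hd := inner_pd_add_inner_pd_of_inner_eq_const hU hu hu (c := 1)
    (fun y hy => by rw [real_inner_self_eq_norm_sq, h y hy, one_pow]) hx i
  rw [real_inner_comm] at hd
  linarith [real_inner_comm (u x) (pd i u x)]

end Inner

/-! ### The cross product -/

section Cross

/-- The cross product of Euclidean three-space, Mathlib's `crossProduct` made into a continuous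
bilinear map in order to differentiate it. -/
def cross : E3 →L[ℝ] E3 →L[ℝ] E3 :=
  let toFun := (WithLp.linearEquiv 2 ℝ (Fin 3 → ℝ)).toLinearMap
  LinearMap.toContinuousBilinearMap ((crossProduct.compl₁₂ toFun toFun).compr₂
    (WithLp.linearEquiv 2 ℝ (Fin 3 → ℝ)).symm.toLinearMap)

theorem ofLp_cross (a b : E3) : (cross a b).ofLp = crossProduct a.ofLp b.ofLp := rfl

theorem inner_eq_dotProduct (a b : E3) : ⟪a, b⟫ = a.ofLp ⬝ᵥ b.ofLp := by
  rw [EuclideanSpace.inner_eq_star_dotProduct, star_trivial, dotProduct_comm]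

theorem cross_self (a : E3) : cross a a = 0 := by
  simp [PiLp.ext_iff, ofLp_cross]

theorem neg_cross_comm (a b : E3) : -cross a b = cross b a := by
  simp only [PiLp.ext_iff, PiLp.neg_apply, ofLp_cross, ← cross_anticomm b.ofLp, Pi.neg_apply,
    neg_neg, implies_true]

theorem inner_left_cross_self (a b : E3) : ⟪a, cross a b⟫ = 0 := by
  rw [inner_eq_dotProduct, ofLp_cross, dot_self_cross]

theorem inner_right_cross_self (a b : E3) : ⟪b, cross a b⟫ = 0 := by
  rw [inner_eq_dotProduct, ofLp_cross, dot_cross_self]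

theorem inner_cross_rotate (a b c : E3) : ⟪a, cross b c⟫ = ⟪b, cross c a⟫ := by
  simp only [inner_eq_dotProduct, ofLp_cross, triple_product_permutation a.ofLp]

theorem inner_cross_cross (a b c d : E3) :
    ⟪cross a b, cross c d⟫ = ⟪a, c⟫ * ⟪b, d⟫ - ⟪a, d⟫ * ⟪b, c⟫ := by
  simp only [inner_eq_dotProduct, ofLp_cross, cross_dot_cross]

theorem cross_cross (a b c : E3) : cross a (cross b c) = ⟪a, c⟫ • b - ⟪a, b⟫ • c := by
  ext i
  simp only [inner_eq_dotProduct, ofLp_cross, cross_cross_eq_smul_sub_smul', PiLp.sub_apply,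
    PiLp.smul_apply, Pi.sub_apply, Pi.smul_apply]
  rw [dotProduct_comm b.ofLp]

theorem cross_ne_zero_iff_linearIndependent {a b : E3} :
    cross a b ≠ 0 ↔ LinearIndependent ℝ ![a, b] := by
  rw [Ne, ← WithLp.ofLp_eq_zero 2, ofLp_cross, ← Ne, crossProduct_ne_zero_iff_linearIndependent]
  simp only [LinearIndependent.pair_iff, ← WithLp.ofLp_smul, ← WithLp.ofLp_add,
    WithLp.ofLp_eq_zero]

theorem mem_span_singleton_of_cross_eq_zero {a b : E3} (hb : b ≠ 0) (h : cross a b = 0) :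
    a ∈ ℝ ∙ b := by
  have hdep : ¬ LinearIndependent ℝ ![a, b] := fun hi =>
    cross_ne_zero_iff_linearIndependent.2 hi h
  rw [LinearIndependent.pair_symm_iff, LinearIndependent.pair_iff' hb] at hdep
  push Not at hdep
  exact Submodule.mem_span_singleton.2 hdep

theorem contDiffOn_cross {U : Set E2} {u v : E2 → E3} (hu : ContDiffOn ℝ ∞ u U)
    (hv : ContDiffOn ℝ ∞ v U) : ContDiffOn ℝ ∞ (fun y => cross (u y) (v y)) U :=
  (cross.contDiff.comp_contDiffOn hu).clm_apply hv

theorem pd_cross {u v : E2 → E3} {x : E2} (hu : DifferentiableAt ℝ u x)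
    (hv : DifferentiableAt ℝ v x) (i : Fin 2) :
    pd i (fun y => cross (u y) (v y)) x = cross (u x) (pd i v x) + cross (pd i u x) (v x) := by
  rw [pd, (cross.hasFDerivAt_of_bilinear hu.hasFDerivAt hv.hasFDerivAt).fderiv]
  rfl

end Cross

/-! ### The oriented plane orthogonal to a unit vector -/

section UnitNormal

variable {n a b : E3}

theorem cross_eq_inner_smul (hn : ‖n‖ = 1) (ha : ⟪n, a⟫ = 0) (hb : ⟪n, b⟫ = 0) :
    cross a b = ⟪n, cross a b⟫ • n := by
  have h : cross n (cross n (cross a b)) = 0 := by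
    rw [cross_cross n a b, ha, hb, zero_smul, zero_smul, sub_zero, map_zero]
  rw [cross_cross, real_inner_self_eq_norm_sq, hn, one_pow, one_smul] at h
  exact (sub_eq_zero.1 h).symm

theorem cross_eq_zero_of_inner_eq_zero (hn : ‖n‖ = 1) (ha : ⟪n, a⟫ = 0) (hb : ⟪n, b⟫ = 0)
    (h : ⟪n, cross a b⟫ = 0) : cross a b = 0 := by
  rw [cross_eq_inner_smul hn ha hb, h, zero_smul]

theorem inner_cross_mul_inner_cross (hn : ‖n‖ = 1) (ha : ⟪n, a⟫ = 0) (hb : ⟪n, b⟫ = 0)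
    (c d : E3) :
    ⟪n, cross a b⟫ * ⟪n, cross c d⟫ = ⟪a, c⟫ * ⟪b, d⟫ - ⟪a, d⟫ * ⟪b, c⟫ := by
  rw [← inner_cross_cross, ← real_inner_smul_left, ← cross_eq_inner_smul hn ha hb]

theorem cross_self_cross (hn : ‖n‖ = 1) (ha : ⟪n, a⟫ = 0) : cross n (cross n a) = -a := by
  rw [cross_cross, ha, real_inner_self_eq_norm_sq, hn, zero_smul, one_pow, one_smul, zero_sub]

theorem inner_cross_self_cross_right (hn : ‖n‖ = 1) (ha : ⟪n, a⟫ = 0) (b : E3) :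
    ⟪n, cross a (cross n b)⟫ = ⟪a, b⟫ := by
  rw [cross_cross, inner_sub_right, real_inner_smul_right, real_inner_smul_right,
    real_inner_self_eq_norm_sq, hn, real_inner_comm n a, ha]
  ring

theorem inner_cross_self_cross_self_cross (hn : ‖n‖ = 1) (a b : E3) :
    ⟪n, cross (cross n a) (cross n b)⟫ = ⟪n, cross a b⟫ := by
  rw [inner_cross_self_cross_right hn (inner_left_cross_self n a), real_inner_comm,
    inner_cross_rotate, inner_cross_rotate]

end UnitNormal

theorem apply_map_map_of_isAlt {R V W : Type*} [CommRing R] [AddCommGroup V] [Module R V]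
    [AddCommGroup W] [Module R W] {B : V →ₗ[R] V →ₗ[R] W} (hB : B.IsAlt)
    (b : Module.Basis (Fin 2) R V) (S : V →ₗ[R] V) :
    B (S (b 0)) (S (b 1)) = LinearMap.det S • B (b 0) (b 1) := by
  have hS : ∀ j, S (b j) = ∑ i, LinearMap.toMatrix b b S i j • b i := fun j => by
    simp only [LinearMap.toMatrix_apply, b.sum_repr]
  rw [← LinearMap.det_toMatrix b, det_fin_two, hS, hS]
  simp only [Fin.sum_univ_two, map_add, map_smul, LinearMap.add_apply, LinearMap.smul_apply,
    hB.self_eq_zero, ← hB.neg (b 0) (b 1)]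
  module

/-! ### Parametrized surfaces -/

/-- A smooth immersion `F` of an open subset `U` of the plane into Euclidean three-space, with a
smooth unit normal field `n`. The coordinate version of `IsSmoothImmersion` and `IsGaussMap`. -/
structure IsParametrizedSurface (U : Set E2) (F n : E2 → E3) : Prop where
  isOpen : IsOpen U
  smooth_map : ContDiffOn ℝ ∞ F U
  smooth_normal : ContDiffOn ℝ ∞ n U
  injective : ∀ x ∈ U, Function.Injective (fderiv ℝ F x)
  norm_normal : ∀ x ∈ U, ‖n x‖ = 1
  inner_normal_pd_map : ∀ x ∈ U, ∀ i, ⟪n x, pd i F x⟫ = 0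

/-- The signed density of the pullback under `u` of the area form of the plane orthogonal to `n`. -/
def areaDensity (n u : E2 → E3) (x : E2) : ℝ :=
  ⟪n x, cross (pd 0 u x) (pd 1 u x)⟫

/-- The Gauss curvature of the parametrized surface `F` with unit normal `n`, encoded as Gauss did:
the ratio of the signed area elements of the spherical image and of the surface. -/
def curvature (F n : E2 → E3) (x : E2) : ℝ :=
  areaDensity n n x / areaDensity n F x

/-- The coefficient matrix of the second fundamental form `-dF · dn`. -/
def secondFormMatrix (F n : E2 → E3) (x : E2) : Matrix (Fin 2) (Fin 2) ℝ :=
  Matrix.of fun i j => -⟪pd i F x, pd j n x⟫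

/-- The components of the cubic form `II((∇ᴵ - ∇ᴵᴵᴵ)_l ∂ᵢ, ∂ⱼ)`, which compares the
Levi-Civita connections of the first and the third fundamental form `dF · dF` and `dn · dn`. -/
def cubicForm (F n : E2 → E3) (x : E2) (l i j : Fin 2) : ℝ :=
  ⟪pd j F x, pd l (pd i n) x⟫ - ⟪pd l (pd i F) x, pd j n x⟫

theorem secondFormMatrix_apply (F n : E2 → E3) (x : E2) (i j : Fin 2) :
    secondFormMatrix F n x i j = -⟪pd i F x, pd j n x⟫ :=
  rfl

theorem pd_areaDensity {U : Set E2} (hU : IsOpen U) {n u : E2 → E3} (hn : ContDiffOn ℝ ∞ n U)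
    (hu : ContDiffOn ℝ ∞ u U) {x : E2} (hx : x ∈ U) (l : Fin 2) :
    pd l (areaDensity n u) x = ⟪n x, cross (pd 0 u x) (pd l (pd 1 u) x)⟫
      + ⟪n x, cross (pd l (pd 0 u) x) (pd 1 u x)⟫ + ⟪pd l n x, cross (pd 0 u x) (pd 1 u x)⟫ := by
  have hd := fun i => differentiableAt_pd hU hu hx i
  have hc := contDiffOn_cross (contDiffOn_pd hU hu 0) (contDiffOn_pd hU hu 1)
  change pd l (fun y => ⟪n y, cross (pd 0 u y) (pd 1 u y)⟫) x = _
  rw [pd_inner (differentiableAt_of_contDiffOn hU hn hx)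
    (differentiableAt_of_contDiffOn hU hc hx), pd_cross (hd 0) (hd 1), inner_add_right]

namespace IsParametrizedSurface

variable {U : Set E2} {F n : E2 → E3} {x : E2}

theorem mono (h : IsParametrizedSurface U F n) {V : Set E2} (hV : IsOpen V) (hVU : V ⊆ U) :
    IsParametrizedSurface V F n where
  isOpen := hV
  smooth_map := h.smooth_map.mono hVU
  smooth_normal := h.smooth_normal.mono hVU
  injective x hx := h.injective x (hVU hx)
  norm_normal x hx := h.norm_normal x (hVU hx)
  inner_normal_pd_map x hx := h.inner_normal_pd_map x (hVU hx)

theorem inner_normal_pd_normal (h : IsParametrizedSurface U F n) (hx : x ∈ U) (i : Fin 2) :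
    ⟪n x, pd i n x⟫ = 0 :=
  inner_pd_self_of_norm_eq_one h.isOpen h.smooth_normal h.norm_normal hx i

theorem cross_pd_map_ne_zero (h : IsParametrizedSurface U F n) (hx : x ∈ U) :
    cross (pd 0 F x) (pd 1 F x) ≠ 0 := by
  have hbasis : ![pd 0 F x, pd 1 F x] =
      (fderiv ℝ F x).toLinearMap ∘ (EuclideanSpace.basisFun (Fin 2) ℝ).toBasis := by
    ext i : 1
    fin_cases i <;> simp [pd]
  rw [cross_ne_zero_iff_linearIndependent, hbasis]
  exact (EuclideanSpace.basisFun (Fin 2) ℝ).toBasis.linearIndependent.map' _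
    (LinearMap.ker_eq_bot.2 (h.injective x hx))

theorem areaDensity_map_ne_zero (h : IsParametrizedSurface U F n) (hx : x ∈ U) :
    areaDensity n F x ≠ 0 := fun h0 =>
  h.cross_pd_map_ne_zero hx (cross_eq_zero_of_inner_eq_zero (h.norm_normal x hx)
    (h.inner_normal_pd_map x hx 0) (h.inner_normal_pd_map x hx 1) h0)

theorem areaDensity_normal (h : IsParametrizedSurface U F n) (hx : x ∈ U) :
    areaDensity n n x = curvature F n x * areaDensity n F x :=
  (div_mul_cancel₀ _ (h.areaDensity_map_ne_zero hx)).symm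

theorem inner_pd_map_pd_normal_comm (h : IsParametrizedSurface U F n) (hx : x ∈ U)
    (i j : Fin 2) : ⟪pd i F x, pd j n x⟫ = ⟪pd j F x, pd i n x⟫ := by
  have hd := fun a b => inner_pd_add_inner_pd_of_inner_eq_const h.isOpen h.smooth_normal
    (contDiffOn_pd h.isOpen h.smooth_map a) (fun y hy => h.inner_normal_pd_map y hy a) hx b
  have hij := hd i j
  have hji := hd j i
  rw [pd_comm h.isOpen h.smooth_map hx] at hji
  rw [real_inner_comm, real_inner_comm (pd i n x)]
  linarith

theorem secondFormMatrix_comm (h : IsParametrizedSurface U F n) (hx : x ∈ U) (i j : Fin 2) :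
    secondFormMatrix F n x i j = secondFormMatrix F n x j i := by
  rw [secondFormMatrix_apply, secondFormMatrix_apply, h.inner_pd_map_pd_normal_comm hx]

theorem det_secondFormMatrix (h : IsParametrizedSurface U F n) (hx : x ∈ U) :
    (secondFormMatrix F n x).det = curvature F n x * areaDensity n F x ^ 2 := by
  have hbc := inner_cross_mul_inner_cross (h.norm_normal x hx) (h.inner_normal_pd_map x hx 0)
    (h.inner_normal_pd_map x hx 1) (pd 0 n x) (pd 1 n x)
  rw [pow_two, ← mul_assoc, ← h.areaDensity_normal hx, mul_comm, areaDensity, areaDensity, hbc]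
  simp [det_fin_two, secondFormMatrix]

theorem tangentialPart_eq_zero_iff (h : IsParametrizedSurface U F n) (hx : x ∈ U) (T : E3) :
    T - ⟪n x, T⟫ • n x = 0 ↔ ∀ l, ⟪pd l F x, T⟫ = 0 := by
  have hn := h.inner_normal_pd_map x hx
  refine ⟨fun hT l => ?_, fun hT => ?_⟩
  · rw [sub_eq_zero.1 hT, real_inner_smul_right, real_inner_comm (n x) (pd l F x), hn, mul_zero]
  · have hnT : cross T (n x) = 0 := by
      have hc : cross T (cross (pd 0 F x) (pd 1 F x)) = 0 := by
        rw [cross_cross, real_inner_comm, hT, real_inner_comm, hT, zero_smul, zero_smul, sub_zero]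
      rw [cross_eq_inner_smul (h.norm_normal x hx) (hn 0) (hn 1), map_smul] at hc
      exact (smul_eq_zero.1 hc).resolve_left (h.areaDensity_map_ne_zero hx)
    have hc := cross_cross (n x) T (n x)
    rwa [hnT, map_zero, real_inner_self_eq_norm_sq, h.norm_normal x hx, one_pow, one_smul,
      eq_comm] at hc

theorem contDiffOn_areaDensity (h : IsParametrizedSurface U F n) {u : E2 → E3}
    (hu : ContDiffOn ℝ ∞ u U) : ContDiffOn ℝ ∞ (areaDensity n u) U :=
  h.smooth_normal.inner ℝ
    (contDiffOn_cross (contDiffOn_pd h.isOpen hu 0) (contDiffOn_pd h.isOpen hu 1))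

theorem contDiffOn_curvature (h : IsParametrizedSurface U F n) :
    ContDiffOn ℝ ∞ (curvature F n) U :=
  (h.contDiffOn_areaDensity h.smooth_normal).div (h.contDiffOn_areaDensity h.smooth_map)
    fun _ hx => h.areaDensity_map_ne_zero hx

theorem pd_inner_pd_map_pd_normal (h : IsParametrizedSurface U F n) (hx : x ∈ U) (l i j : Fin 2) :
    pd l (fun y => ⟪pd i F y, pd j n y⟫) x
      = ⟪pd i F x, pd l (pd j n) x⟫ + ⟪pd l (pd i F) x, pd j n x⟫ :=
  pd_inner (differentiableAt_pd h.isOpen h.smooth_map hx i)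
    (differentiableAt_pd h.isOpen h.smooth_normal hx j) l

theorem cubicForm_swap_left (h : IsParametrizedSurface U F n) (hx : x ∈ U) (l i j : Fin 2) :
    cubicForm F n x l i j = cubicForm F n x i l j := by
  rw [cubicForm, cubicForm, pd_comm h.isOpen h.smooth_normal hx, pd_comm h.isOpen h.smooth_map hx]

theorem cubicForm_swap_right (h : IsParametrizedSurface U F n) (hx : x ∈ U) (l i j : Fin 2) :
    cubicForm F n x l i j = cubicForm F n x l j i := by
  have hd := pd_congr_of_eqOn h.isOpen
    (fun y hy => h.inner_pd_map_pd_normal_comm hy i j) hx l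
  rw [h.pd_inner_pd_map_pd_normal hx, h.pd_inner_pd_map_pd_normal hx] at hd
  rw [cubicForm, cubicForm]
  linarith

theorem inner_pd_normal_cross_eq_zero (h : IsParametrizedSurface U F n) (hx : x ∈ U) {a b : E3}
    (ha : ⟪n x, a⟫ = 0) (hb : ⟪n x, b⟫ = 0) (l : Fin 2) : ⟪pd l n x, cross a b⟫ = 0 := by
  rw [cross_eq_inner_smul (h.norm_normal x hx) ha hb, real_inner_smul_right,
    real_inner_comm (n x) (pd l n x), h.inner_normal_pd_normal hx, mul_zero]

theorem areaDensity_sq_mul_pd_curvature (h : IsParametrizedSurface U F n) (hx : x ∈ U)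
    (l : Fin 2) :
    areaDensity n F x ^ 2 * pd l (curvature F n) x
      = 2 * secondFormMatrix F n x 0 1 * cubicForm F n x l 0 1
        - secondFormMatrix F n x 1 1 * cubicForm F n x l 0 0
        - secondFormMatrix F n x 0 0 * cubicForm F n x l 1 1 := by
  have hu := h.norm_normal x hx
  have hF := h.inner_normal_pd_map x hx
  have hn := h.inner_normal_pd_normal hx
  have hquot : areaDensity n F x ^ 2 * pd l (curvature F n) x
      = areaDensity n F x * pd l (areaDensity n n) x
        - areaDensity n n x * pd l (areaDensity n F) x := by
    rw [pd_congr_of_eqOn h.isOpen (fun y hy => h.areaDensity_normal hy) hx l,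
      pd_mul (differentiableAt_of_contDiffOn h.isOpen h.contDiffOn_curvature hx)
        (differentiableAt_of_contDiffOn h.isOpen (h.contDiffOn_areaDensity h.smooth_map) hx),
      h.areaDensity_normal hx]
    ring
  have hbcF := inner_cross_mul_inner_cross hu (hF 0) (hF 1)
  have hbcn := inner_cross_mul_inner_cross hu (hn 0) (hn 1)
  have hsymm := h.inner_pd_map_pd_normal_comm hx 1 0
  have hcubic := h.cubicForm_swap_right hx l 1 0
  rw [hquot, pd_areaDensity h.isOpen h.smooth_normal h.smooth_normal hx,
    pd_areaDensity h.isOpen h.smooth_normal h.smooth_map hx,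
    h.inner_pd_normal_cross_eq_zero hx (hn 0) (hn 1),
    h.inner_pd_normal_cross_eq_zero hx (hF 0) (hF 1), add_zero, add_zero, mul_add, mul_add,
    areaDensity, areaDensity, hbcF, hbcF, hbcn, hbcn]
  simp only [secondFormMatrix_apply, cubicForm, real_inner_comm (pd _ F x) (pd _ n x),
    real_inner_comm (pd _ (pd _ F) x) (pd _ n x), hsymm] at hcubic ⊢
  linear_combination -⟪pd 0 F x, pd 1 n x⟫ * hcubic

end IsParametrizedSurface

/-! ### The tension field of the Gauss map -/

section Christoffel

variable {G G' : E2 → Matrix (Fin 2) (Fin 2) ℝ} {x : E2}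

theorem christoffel_congr (h : G =ᶠ[nhds x] G') (k i j : Fin 2) :
    christoffel G k i j x = christoffel G' k i j x := by
  have hpd : ∀ a b c, pd a (fun y => G y b c) x = pd a (fun y => G' y b c) x := fun a b c =>
    pd_congr (h.mono fun y hy => congrFun (congrFun hy b) c) a
  simp only [christoffel, h.eq_of_nhds, hpd]

theorem traceHessian_congr (h : G =ᶠ[nhds x] G') (u : E2 → E3) :
    traceHessian G u x = traceHessian G' u x := by
  simp only [traceHessian, christoffel_congr h, h.eq_of_nhds]

theorem sum_mul_christoffel (hG : (G x).det ≠ 0) (l i j : Fin 2) :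
    ∑ k, G x l k * christoffel G k i j x
      = (1 / 2) * (pd i (fun y => G y j l) x + pd j (fun y => G y i l) x
        - pd l (fun y => G y i j) x) := by
  set w : Fin 2 → ℝ := fun m =>
    pd i (fun y => G y j m) x + pd j (fun y => G y i m) x - pd m (fun y => G y i j) x
  have hchr : (fun k => christoffel G k i j x) = (1 / 2 : ℝ) • ((G x)⁻¹ *ᵥ w) := rfl
  have hmul : G x *ᵥ (fun k => christoffel G k i j x) = (1 / 2 : ℝ) • w := by
    rw [hchr, mulVec_smul, mulVec_mulVec, mul_nonsing_inv _ hG.isUnit, one_mulVec]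
  exact congrFun hmul l

end Christoffel

namespace IsParametrizedSurface

variable {U : Set E2} {F n : E2 → E3} {x : E2}

theorem pd_secondFormMatrix (h : IsParametrizedSurface U F n) (hx : x ∈ U) (l i j : Fin 2) :
    pd l (fun y => secondFormMatrix F n y i j) x
      = -(⟪pd i F x, pd l (pd j n) x⟫ + ⟪pd l (pd i F) x, pd j n x⟫) := by
  rw [← h.pd_inner_pd_map_pd_normal hx]
  exact pd_neg _ l x

-- The left side is `∇dn` for the Levi-Civita connection of `II`, which is the average of those of
-- the first and the third fundamental form.
theorem inner_pd_map_hessian (h : IsParametrizedSurface U F n) (hx : x ∈ U)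
    (hk : curvature F n x ≠ 0) (l i j : Fin 2) :
    ⟪pd l F x, pd i (pd j n) x - ∑ m, christoffel (secondFormMatrix F n) m i j x • pd m n x⟫
      = (1 / 2) * cubicForm F n x l i j := by
  have hdet : (secondFormMatrix F n x).det ≠ 0 := by
    rw [h.det_secondFormMatrix hx]
    exact mul_ne_zero hk (pow_ne_zero 2 (h.areaDensity_map_ne_zero hx))
  have hconn : ⟪pd l F x, ∑ m, christoffel (secondFormMatrix F n) m i j x • pd m n x⟫
      = -∑ m, secondFormMatrix F n x l m * christoffel (secondFormMatrix F n) m i j x := by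
    simp only [inner_sum, real_inner_smul_right, secondFormMatrix_apply, ← Finset.sum_neg_distrib]
    exact Finset.sum_congr rfl fun m _ => by ring
  have hswap : ∀ a b c, pd a (fun y => secondFormMatrix F n y b c) x
      = pd a (fun y => secondFormMatrix F n y c b) x := fun a b c =>
    pd_congr_of_eqOn h.isOpen (fun y hy => h.secondFormMatrix_comm hy b c) hx a
  rw [inner_sub_right, hconn, sum_mul_christoffel hdet, hswap i, hswap j, hswap l,
    h.pd_secondFormMatrix hx, h.pd_secondFormMatrix hx, h.pd_secondFormMatrix hx, cubicForm,
    pd_comm h.isOpen h.smooth_normal hx j i, pd_comm h.isOpen h.smooth_map hx l i,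
    pd_comm h.isOpen h.smooth_map hx l j]
  ring

theorem sum_inv_secondFormMatrix_mul_cubicForm (h : IsParametrizedSurface U F n) (hx : x ∈ U)
    (hk : curvature F n x ≠ 0) (l : Fin 2) :
    ∑ i, ∑ j, (secondFormMatrix F n x)⁻¹ i j * cubicForm F n x l i j
      = -(pd l (curvature F n) x / curvature F n x) := by
  have hD := h.areaDensity_map_ne_zero hx
  have hpd := h.areaDensity_sq_mul_pd_curvature hx l
  have hinv : ∀ i j, (secondFormMatrix F n x)⁻¹ i j
      = (curvature F n x * areaDensity n F x ^ 2)⁻¹ * (secondFormMatrix F n x).adjugate i j := by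
    intro i j
    rw [inv_def, h.det_secondFormMatrix hx, Ring.inverse_eq_inv']
    rfl
  simp only [hinv, adjugate_fin_two, Fin.sum_univ_two, of_apply, cons_val_zero, cons_val_one,
    h.secondFormMatrix_comm hx 1 0, h.cubicForm_swap_right hx l 1 0]
  field_simp
  linear_combination hpd

theorem inner_pd_map_traceHessian (h : IsParametrizedSurface U F n) (hx : x ∈ U)
    (hk : curvature F n x ≠ 0) (l : Fin 2) :
    ⟪pd l F x, traceHessian (secondFormMatrix F n) n x⟫
      = -(1 / 2) * (pd l (curvature F n) x / curvature F n x) := by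
  simp only [traceHessian, inner_sum, real_inner_smul_right, h.inner_pd_map_hessian hx hk]
  simp only [mul_left_comm _ (1 / 2 : ℝ), ← Finset.mul_sum,
    h.sum_inv_secondFormMatrix_mul_cubicForm hx hk]
  ring

theorem tangentialPart_traceHessian_eq_zero_iff (h : IsParametrizedSurface U F n) (hx : x ∈ U)
    (hk : curvature F n x ≠ 0) :
    traceHessian (secondFormMatrix F n) n x
        - ⟪n x, traceHessian (secondFormMatrix F n) n x⟫ • n x = 0
      ↔ ∀ l, pd l (curvature F n) x = 0 := by
  simp [h.tangentialPart_eq_zero_iff hx, h.inner_pd_map_traceHessian hx hk, hk]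

/-! ### The curvature in Tchebyshev coordinates -/

theorem inner_pd_pd_map_pd_normal_eq_zero (h : IsParametrizedSurface U F n)
    (hunit : ∀ y ∈ U, ∀ i, ‖pd i F y‖ = 1) (hx : x ∈ U) (j : Fin 2) :
    ⟪pd 0 (pd 1 F) x, pd j n x⟫ = 0 := by
  have horth : ∀ l, ⟪pd l F x, pd 0 (pd 1 F) x⟫ = 0 := by
    have hd := fun i => inner_pd_self_of_norm_eq_one h.isOpen
      (contDiffOn_pd h.isOpen h.smooth_map i) (fun y hy => hunit y hy i) hx
    intro l
    fin_cases l
    · exact pd_comm h.isOpen h.smooth_map hx 0 1 ▸ hd 0 1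
    · exact hd 1 0
  rw [sub_eq_zero.1 ((h.tangentialPart_eq_zero_iff hx _).2 horth), real_inner_smul_left,
    h.inner_normal_pd_normal hx, mul_zero]

theorem cubicForm_zero_one_eq_zero (h : IsParametrizedSurface U F n)
    (hasymp : ∀ y ∈ U, ∀ i, ⟪pd i n y, pd i F y⟫ = 0) (hunit : ∀ y ∈ U, ∀ i, ‖pd i F y‖ = 1)
    (hx : x ∈ U) (l : Fin 2) : cubicForm F n x l 0 1 = 0 := by
  have hdiag : ∀ a i, pd a (pd i F) x = pd 0 (pd 1 F) x → cubicForm F n x a i i = 0 := by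
    intro a i hai
    have hd := pd_congr_of_eqOn h.isOpen
      (fun y hy => (real_inner_comm _ _).trans (hasymp y hy i)) hx a
    rw [h.pd_inner_pd_map_pd_normal hx, pd_const, hai,
      h.inner_pd_pd_map_pd_normal_eq_zero hunit hx, add_zero] at hd
    rw [cubicForm, hai, hd, h.inner_pd_pd_map_pd_normal_eq_zero hunit hx, sub_zero]
  fin_cases l
  · exact (h.cubicForm_swap_right hx 0 0 1).trans ((h.cubicForm_swap_left hx 0 1 0).trans
      (hdiag 1 0 (pd_comm h.isOpen h.smooth_map hx 1 0)))
  · exact (h.cubicForm_swap_left hx 1 0 1).trans (hdiag 0 1 rfl)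

theorem pd_curvature_eq_zero (h : IsParametrizedSurface U F n)
    (hasymp : ∀ y ∈ U, ∀ i, ⟪pd i n y, pd i F y⟫ = 0) (hunit : ∀ y ∈ U, ∀ i, ‖pd i F y‖ = 1)
    (hx : x ∈ U) (l : Fin 2) : pd l (curvature F n) x = 0 := by
  have hdiag : ∀ i, secondFormMatrix F n x i i = 0 := fun i => by
    rw [secondFormMatrix_apply, real_inner_comm, hasymp x hx, neg_zero]
  have hpd := h.areaDensity_sq_mul_pd_curvature hx l
  rw [hdiag, hdiag, h.cubicForm_zero_one_eq_zero hasymp hunit hx] at hpd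
  simpa [h.areaDensity_map_ne_zero hx] using hpd

end IsParametrizedSurface

/-! ### Closed one-forms and local diffeomorphisms -/

/-- The vector-valued one-form with components `α 0`, `α 1` is smooth and closed on `V`. -/
structure IsClosedForm {H : Type*} [NormedAddCommGroup H] [NormedSpace ℝ H] (V : Set E2)
    (α : Fin 2 → E2 → H) : Prop where
  smooth : ∀ i, ContDiffOn ℝ ∞ (α i) V
  pd_comm : ∀ x ∈ V, ∀ i j, pd i (α j) x = pd j (α i) x

namespace IsClosedForm

variable {H : Type*} [NormedAddCommGroup H] [NormedSpace ℝ H] {V W : Set E2} {α : Fin 2 → E2 → H}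

theorem mono (h : IsClosedForm V α) (hWV : W ⊆ V) : IsClosedForm W α where
  smooth i := (h.smooth i).mono hWV
  pd_comm x hx := h.pd_comm x (hWV hx)

theorem exists_potential [CompleteSpace H] (h : IsClosedForm V α) (hV : IsOpen V)
    (hconv : Convex ℝ V) :
    ∃ ξ : E2 → H, ContDiffOn ℝ ∞ ξ V ∧ ∀ x ∈ V, ∀ i, pd i ξ x = α i x := by
  let θ : E2 → E2 →L[ℝ] H := fun x => ∑ i, (EuclideanSpace.proj i).smulRight (α i x)
  have hθ_single : ∀ x i, θ x (EuclideanSpace.single i 1) = α i x := fun x i => by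
    fin_cases i <;> simp [θ]
  have hθ : ContDiffOn ℝ ∞ θ V := ContDiffOn.sum fun i _ =>
    (ContinuousLinearMap.smulRightL ℝ E2 H (EuclideanSpace.proj i)).contDiff.comp_contDiffOn
      (h.smooth i)
  have hsymm : ∀ x ∈ V, fderiv ℝ θ x = (fderiv ℝ θ x).flip := fun x hx => by
    have hd := differentiableAt_of_contDiffOn hV hθ hx
    refine clm_ext fun i => clm_ext fun j => ?_
    rw [ContinuousLinearMap.flip_apply, ← pd_clm_apply hd, ← pd_clm_apply hd]
    simp only [hθ_single, h.pd_comm x hx i j]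
  obtain ⟨ξ, hξ⟩ := hconv.exists_forall_hasFDerivAt_of_fderiv_symmetric hV
    (hθ.differentiableOn (by simp))
    fun x hx v w => congrArg (fun L : E2 →L[ℝ] E2 →L[ℝ] H => L v w) (hsymm x hx)
  refine ⟨ξ, ?_, fun x hx i => ?_⟩
  · rw [contDiffOn_infty_iff_fderiv_of_isOpen hV]
    exact ⟨fun x hx => (hξ x hx).differentiableAt.differentiableWithinAt,
      hθ.congr fun x hx => (hξ x hx).fderiv⟩
  · rw [pd, (hξ x hx).fderiv, hθ_single]

theorem exists_potential_map {α : Fin 2 → Fin 2 → E2 → ℝ} (h : ∀ a, IsClosedForm V (α a))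
    (hV : IsOpen V) (hconv : Convex ℝ V) :
    ∃ Φ : E2 → E2, ContDiffOn ℝ ∞ Φ V ∧ ∀ x ∈ V, ∀ i a, pd i Φ x a = α a i x := by
  choose ξ hξ_smooth hξ using fun a => (h a).exists_potential hV hconv
  have hΦ : ContDiffOn ℝ ∞ (fun x => WithLp.toLp 2 fun a => ξ a x : E2 → E2) V :=
    contDiffOn_euclidean.2 hξ_smooth
  refine ⟨_, hΦ, fun x hx i a => ?_⟩
  have hcoord := (EuclideanSpace.proj (𝕜 := ℝ) a).hasFDerivAt.comp x
    (differentiableAt_of_contDiffOn hV hΦ hx).hasFDerivAt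
  rw [← hξ a x hx i]
  exact (congrArg (fun L => L (EuclideanSpace.single i 1)) hcoord.fderiv).symm

end IsClosedForm

theorem exists_isClosedForm_smul_of_mem_span {H : Type*} [NormedAddCommGroup H]
    [InnerProductSpace ℝ H] {V : Set E2} (hV : IsOpen V) {A : Fin 2 → E2 → H}
    (hA : ∀ i, ContDiffOn ℝ ∞ (A i) V) {j : Fin 2} (hj : ∀ x ∈ V, A j x ≠ 0)
    (hspan : ∀ x ∈ V, ∀ i, A i x ∈ ℝ ∙ A j x)
    (hd : ∀ x ∈ V, ∀ i k, ⟪A j x, pd i (A k) x - pd k (A i) x⟫ = 0) :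
    ∃ (α : Fin 2 → E2 → ℝ) (u : E2 → H), IsClosedForm V α ∧ (∀ x ∈ V, ‖u x‖ = 1) ∧
      ∀ x ∈ V, ∀ i, A i x = α i x • u x := by
  let u : E2 → H := fun x => NormedSpace.normalize (A j x)
  have hu_smooth : ContDiffOn ℝ ∞ u V :=
    (((hA j).norm ℝ hj).inv fun x hx => norm_ne_zero_iff.2 (hj x hx)).smul (hA j)
  have hu : ∀ x ∈ V, ‖u x‖ = 1 := fun x hx => NormedSpace.norm_normalize_eq_one_iff.2 (hj x hx)
  have hA_eq : ∀ x ∈ V, ∀ i, A i x = ⟪A i x, u x⟫ • u x := by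
    intro x hx i
    obtain ⟨c, hc⟩ := Submodule.mem_span_singleton.1 (hspan x hx i)
    rw [← hc, ← NormedSpace.norm_smul_normalize (A j x), real_inner_smul_left,
      real_inner_smul_left, real_inner_self_eq_norm_sq, hu x hx, one_pow, mul_one, smul_smul]
  -- The derivative of `u` does not contribute, since `A i` is a multiple of the unit vector `u`.
  have hpd : ∀ x ∈ V, ∀ i k, pd k (fun y => ⟪A i y, u y⟫) x = ⟪pd k (A i) x, u x⟫ := by
    intro x hx i k
    rw [pd_inner (differentiableAt_of_contDiffOn hV (hA i) hx)
      (differentiableAt_of_contDiffOn hV hu_smooth hx), hA_eq x hx i, real_inner_smul_left,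
      inner_pd_self_of_norm_eq_one hV hu_smooth hu hx, mul_zero, zero_add]
  refine ⟨fun i x => ⟪A i x, u x⟫, u, ⟨fun i => (hA i).inner ℝ hu_smooth, fun x hx i k => ?_⟩,
    hu, hA_eq⟩
  rw [hpd x hx, hpd x hx, ← sub_eq_zero, ← inner_sub_left, real_inner_comm,
    show u x = ‖A j x‖⁻¹ • A j x from rfl, real_inner_smul_left, hd x hx, mul_zero]

section LocalDiffeomorphism

variable {E : Type*} [NormedAddCommGroup E] [NormedSpace ℝ E]

theorem exists_openPartialHomeomorph_of_injective_fderiv [FiniteDimensional ℝ E] {m : WithTop ℕ∞}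
    (hm : m ≠ 0) {Φ : E → E} {V : Set E} (hV : IsOpen V) (hΦ : ContDiffOn ℝ m Φ V)
    (hinj : ∀ x ∈ V, Function.Injective (fderiv ℝ Φ x)) {x₀ : E} (hx₀ : x₀ ∈ V) :
    ∃ φ : OpenPartialHomeomorph E E, x₀ ∈ φ.source ∧ φ.source ⊆ V ∧ φ = Φ ∧
      ContDiffOn ℝ m φ.symm φ.target := by
  have hat : ∀ x ∈ V, ContDiffAt ℝ m Φ x := fun x hx => hΦ.contDiffAt (hV.mem_nhds hx)
  have hequiv : ∀ x ∈ V, ∃ L : E ≃L[ℝ] E, HasFDerivAt Φ (L : E →L[ℝ] E) x := fun x hx =>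
    ⟨(LinearEquiv.ofInjectiveEndo (fderiv ℝ Φ x).toLinearMap (hinj x hx)).toContinuousLinearEquiv,
      ((hat x hx).differentiableAt hm).hasFDerivAt⟩
  obtain ⟨L, hL⟩ := hequiv x₀ hx₀
  let φ := ((hat x₀ hx₀).toOpenPartialHomeomorph Φ hL hm).restrOpen V hV
  have hφV : φ.source ⊆ V := fun x hx => hx.2
  refine ⟨φ, ⟨(hat x₀ hx₀).mem_toOpenPartialHomeomorph_source hL hm, hx₀⟩, hφV, rfl,
    fun y hy => ?_⟩
  obtain ⟨L', hL'⟩ := hequiv _ (hφV (φ.map_target hy))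
  exact (φ.contDiffAt_symm hy hL' (hat _ (hφV (φ.map_target hy)))).contDiffWithinAt

theorem fderiv_comp_symm_eq_of_fderiv_eq_comp {H : Type*} [NormedAddCommGroup H]
    [NormedSpace ℝ H] {φ : OpenPartialHomeomorph E E} {y : E} (hy : y ∈ φ.target)
    (hφ : DifferentiableAt ℝ φ (φ.symm y)) (hφ' : DifferentiableAt ℝ φ.symm y) {g : E → H}
    (hg : DifferentiableAt ℝ g (φ.symm y)) {L : E →L[ℝ] H}
    (hL : fderiv ℝ g (φ.symm y) = L ∘L fderiv ℝ φ (φ.symm y)) :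
    fderiv ℝ (g ∘ φ.symm) y = L := by
  have hid : fderiv ℝ φ (φ.symm y) ∘L fderiv ℝ φ.symm y = ContinuousLinearMap.id ℝ E := by
    have hinv : φ ∘ φ.symm =ᶠ[nhds y] id := φ.eventually_right_inverse hy
    rw [← fderiv_comp y hφ hφ', hinv.fderiv_eq, fderiv_id]
  rw [fderiv_comp y hg hφ', hL, ContinuousLinearMap.comp_assoc, hid, ContinuousLinearMap.comp_id]

end LocalDiffeomorphism

section AdaptedCoordinates

variable {H : Type*} [NormedAddCommGroup H] [NormedSpace ℝ H] {g : E2 → H} {u : Fin 2 → H}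

theorem fderiv_eq_comp_of_pd_eq_sum {Φ : E2 → E2} {x : E2}
    (h : ∀ i, pd i g x = ∑ a, pd i Φ x a • u a) :
    fderiv ℝ g x = (∑ a, (EuclideanSpace.proj a).smulRight (u a)) ∘L fderiv ℝ Φ x :=
  clm_ext fun i => (h i).trans (by simp [pd])

theorem pd_comp_symm_eq_of_pd_eq_sum {φ : OpenPartialHomeomorph E2 E2} {y : E2}
    (hy : y ∈ φ.target) (hφ : DifferentiableAt ℝ φ (φ.symm y))
    (hφ' : DifferentiableAt ℝ φ.symm y) (hg : DifferentiableAt ℝ g (φ.symm y))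
    (h : ∀ i, pd i g (φ.symm y) = ∑ a, pd i φ (φ.symm y) a • u a) (a : Fin 2) :
    pd a (g ∘ φ.symm) y = u a := by
  rw [pd, fderiv_comp_symm_eq_of_fderiv_eq_comp hy hφ hφ' hg (fderiv_eq_comp_of_pd_eq_sum h)]
  fin_cases a <;> simp

end AdaptedCoordinates

/-! ### Tchebyshev coordinates on a surface of constant negative curvature -/

/-- The component in the direction `∂ᵢ` of the form `(df + r n × dn) / 2`. Where `r ^ 2 K = -1` this
is the projection of `df` onto an asymptotic direction along the other one; changing the sign of `r`
exchanges the two directions. -/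
def asymptoticForm (F n : E2 → E3) (r : ℝ) (i : Fin 2) (x : E2) : E3 :=
  (1 / 2 : ℝ) • (pd i F x + r • cross (n x) (pd i n x))

/-- Two closed one-forms `α 0`, `α 1` with `dF = ∑ αₐ uₐ` and `dn = ∑ αₐ wₐ`, where `uₐ` is a unit
vector orthogonal to `wₐ`. Potentials of `α 0` and `α 1` are Tchebyshev coordinates. -/
structure IsTchebyshevCoframe (V : Set E2) (F n : E2 → E3) (α : Fin 2 → Fin 2 → E2 → ℝ)
    (u w : Fin 2 → E2 → E3) : Prop where
  isClosedForm : ∀ a, IsClosedForm V (α a)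
  norm_eq_one : ∀ x ∈ V, ∀ a, ‖u a x‖ = 1
  inner_eq_zero : ∀ x ∈ V, ∀ a, ⟪w a x, u a x⟫ = 0
  pd_map : ∀ x ∈ V, ∀ i, pd i F x = ∑ a, α a i x • u a x
  pd_normal : ∀ x ∈ V, ∀ i, pd i n x = ∑ a, α a i x • w a x

namespace IsParametrizedSurface

variable {U : Set E2} {F n : E2 → E3} {x : E2} {r : ℝ}

theorem contDiffOn_asymptoticForm (h : IsParametrizedSurface U F n) (r : ℝ) (i : Fin 2) :
    ContDiffOn ℝ ∞ (asymptoticForm F n r i) U :=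
  ((contDiffOn_pd h.isOpen h.smooth_map i).add ((contDiffOn_cross h.smooth_normal
    (contDiffOn_pd h.isOpen h.smooth_normal i)).const_smul r)).const_smul (1 / 2 : ℝ)

theorem inner_normal_asymptoticForm (h : IsParametrizedSurface U F n) (hx : x ∈ U) (r : ℝ)
    (i : Fin 2) : ⟪n x, asymptoticForm F n r i x⟫ = 0 := by
  simp [asymptoticForm, inner_add_right, real_inner_smul_right, h.inner_normal_pd_map x hx,
    inner_left_cross_self]

theorem cross_asymptoticForm_eq_zero (h : IsParametrizedSurface U F n) (hx : x ∈ U)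
    (hr : r ^ 2 * curvature F n x = -1) (i j : Fin 2) :
    cross (asymptoticForm F n r i x) (asymptoticForm F n r j x) = 0 := by
  have hu := h.norm_normal x hx
  have hF := h.inner_normal_pd_map x hx
  have h01 : cross (asymptoticForm F n r 0 x) (asymptoticForm F n r 1 x) = 0 := by
    refine cross_eq_zero_of_inner_eq_zero hu (h.inner_normal_asymptoticForm hx r 0)
      (h.inner_normal_asymptoticForm hx r 1) ?_
    have hmixed : ⟪n x, cross (cross (n x) (pd 0 n x)) (pd 1 F x)⟫ = -⟪pd 1 F x, pd 0 n x⟫ := by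
      rw [← neg_cross_comm, inner_neg_right, inner_cross_self_cross_right hu (hF 1)]
    have hnn : ⟪n x, cross (pd 0 n x) (pd 1 n x)⟫
        = curvature F n x * ⟪n x, cross (pd 0 F x) (pd 1 F x)⟫ := h.areaDensity_normal hx
    simp only [asymptoticForm, map_add, map_smul, _root_.add_apply, _root_.smul_apply,
      inner_add_right, real_inner_smul_right, inner_cross_self_cross_right hu (hF 0), hmixed,
      inner_cross_self_cross_self_cross hu, hnn, h.inner_pd_map_pd_normal_comm hx 1 0]
    linear_combination (1 / 4) * ⟪n x, cross (pd 0 F x) (pd 1 F x)⟫ * hr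
  fin_cases i <;> fin_cases j
  · exact cross_self _
  · exact h01
  · exact (neg_cross_comm _ _).symm.trans (neg_eq_zero.2 h01)
  · exact cross_self _

theorem exists_asymptoticForm_ne_zero (h : IsParametrizedSurface U F n) (hx : x ∈ U)
    (hr : r ^ 2 * curvature F n x = -1) : ∃ j, asymptoticForm F n r j x ≠ 0 := by
  by_contra! hzero
  have hF : ∀ i, pd i F x = -(r • cross (n x) (pd i n x)) := fun i =>
    eq_neg_of_add_eq_zero_left ((smul_eq_zero.1 (hzero i)).resolve_left (by norm_num))
  refine h.areaDensity_map_ne_zero hx ?_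
  have hD : areaDensity n F x = r ^ 2 * areaDensity n n x := by
    simp only [areaDensity, hF, map_neg, map_smul, _root_.neg_apply, _root_.smul_apply,
      smul_neg, neg_neg, real_inner_smul_right,
      inner_cross_self_cross_self_cross (h.norm_normal x hx)]
    ring
  rw [h.areaDensity_normal hx, ← mul_assoc, hr] at hD
  linarith

theorem pd_asymptoticForm_sub (h : IsParametrizedSurface U F n) (hx : x ∈ U) (r : ℝ)
    (i j : Fin 2) :
    pd i (asymptoticForm F n r j) x - pd j (asymptoticForm F n r i) x
      = r • cross (pd i n x) (pd j n x) := by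
  have hn := differentiableAt_of_contDiffOn h.isOpen h.smooth_normal hx
  have hpd : ∀ a b, pd a (asymptoticForm F n r b) x = (1 / 2 : ℝ) • (pd a (pd b F) x
      + r • (cross (n x) (pd a (pd b n) x) + cross (pd a n x) (pd b n x))) := fun a b => by
    have hF' := differentiableAt_pd h.isOpen h.smooth_map hx b
    have hn' := differentiableAt_pd h.isOpen h.smooth_normal hx b
    have hc : DifferentiableAt ℝ (fun y => cross (n y) (pd b n y)) x :=
      differentiableAt_of_contDiffOn h.isOpen
        (contDiffOn_cross h.smooth_normal (contDiffOn_pd h.isOpen h.smooth_normal b)) hx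
    have hrc : DifferentiableAt ℝ (fun y => r • cross (n y) (pd b n y)) x := hc.const_smul r
    rw [← pd_cross hn hn', ← pd_const_smul hc, ← pd_add hF' hrc]
    exact pd_const_smul (hF'.add hrc) _ _
  rw [hpd, hpd, pd_comm h.isOpen h.smooth_map hx j i, pd_comm h.isOpen h.smooth_normal hx j i,
    ← neg_cross_comm (pd i n x)]
  module

theorem exists_asymptoticForm_eq_smul (h : IsParametrizedSurface U F n)
    (hr : ∀ y ∈ U, r ^ 2 * curvature F n y = -1) (hx : x ∈ U) :
    ∃ V ⊆ U, IsOpen V ∧ x ∈ V ∧ ∃ (α : Fin 2 → E2 → ℝ) (u : E2 → E3), IsClosedForm V α ∧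
      (∀ y ∈ V, ‖u y‖ = 1) ∧ ∀ y ∈ V, ∀ i, asymptoticForm F n r i y = α i y • u y := by
  obtain ⟨j, hj⟩ := h.exists_asymptoticForm_ne_zero hx (hr x hx)
  have hsmooth := h.contDiffOn_asymptoticForm r
  have hVU : U ∩ asymptoticForm F n r j ⁻¹' {0}ᶜ ⊆ U := Set.inter_subset_left
  have hV := (hsmooth j).continuousOn.isOpen_inter_preimage h.isOpen
    (isOpen_compl_singleton (x := (0 : E3)))
  refine ⟨_, hVU, hV, ⟨hx, hj⟩, exists_isClosedForm_smul_of_mem_span hV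
    (fun i => (hsmooth i).mono hVU) (fun y hy => hy.2) (fun y hy i => ?_) (fun y hy i k => ?_)⟩
  · exact mem_span_singleton_of_cross_eq_zero hy.2
      (h.cross_asymptoticForm_eq_zero hy.1 (hr y hy.1) i j)
  · rw [h.pd_asymptoticForm_sub hy.1, cross_eq_inner_smul (h.norm_normal y hy.1)
      (h.inner_normal_pd_normal hy.1 i) (h.inner_normal_pd_normal hy.1 k), real_inner_smul_right,
      real_inner_smul_right, real_inner_comm (n y), h.inner_normal_asymptoticForm hy.1, mul_zero,
      mul_zero]

theorem exists_isTchebyshevCoframe (h : IsParametrizedSurface U F n)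
    (hr : ∀ y ∈ U, r ^ 2 * curvature F n y = -1) (hx : x ∈ U) :
    ∃ V ⊆ U, IsOpen V ∧ Convex ℝ V ∧ x ∈ V ∧ ∃ α u w, IsTchebyshevCoframe V F n α u w := by
  have hr0 : r ≠ 0 := by
    rintro rfl
    simpa using hr x hx
  obtain ⟨V₁, hV₁U, hV₁, hxV₁, α, u, hα, hu, hAα⟩ := h.exists_asymptoticForm_eq_smul hr hx
  obtain ⟨V₂, -, hV₂, hxV₂, β, v, hβ, hv, hAβ⟩ :=
    h.exists_asymptoticForm_eq_smul (r := -r) (by simpa using hr) hx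
  obtain ⟨ε, hε, hball⟩ := Metric.isOpen_iff.1 (hV₁.inter hV₂) x ⟨hxV₁, hxV₂⟩
  have hB₁ : Metric.ball x ε ⊆ V₁ := fun y hy => (hball hy).1
  have hB₂ : Metric.ball x ε ⊆ V₂ := fun y hy => (hball hy).2
  refine ⟨Metric.ball x ε, hB₁.trans hV₁U, Metric.isOpen_ball, convex_ball x ε,
    Metric.mem_ball_self hε, ![α, β], ![u, v],
    ![fun y => -r⁻¹ • cross (n y) (u y), fun y => r⁻¹ • cross (n y) (v y)], ?_, ?_, ?_, ?_, ?_⟩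
  · simp only [Fin.forall_fin_two]
    exact ⟨hα.mono hB₁, hβ.mono hB₂⟩
  · simp only [Fin.forall_fin_two]
    exact fun y hy => ⟨hu y (hB₁ hy), hv y (hB₂ hy)⟩
  · have hperp : ∀ (s : ℝ) (a b : E3), ⟪s • cross a b, b⟫ = 0 := fun s a b => by
      rw [real_inner_smul_left, real_inner_comm, inner_right_cross_self, mul_zero]
    simp only [Fin.forall_fin_two]
    exact fun y _ => ⟨hperp _ _ _, hperp _ _ _⟩
  · intro y hy i
    simp only [Fin.sum_univ_two, cons_val_zero, cons_val_one, ← hAα y (hB₁ hy),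
      ← hAβ y (hB₂ hy), asymptoticForm]
    module
  · intro y hy i
    have hcross : cross (n y) (pd i n y) = r⁻¹ • (α i y • u y - β i y • v y) := by
      simp only [← hAα y (hB₁ hy), ← hAβ y (hB₂ hy), asymptoticForm]
      rw [eq_inv_smul_iff₀ hr0]
      module
    have hyU := hV₁U (hB₁ hy)
    rw [← neg_neg (pd i n y), ← cross_self_cross (h.norm_normal y hyU)
      (h.inner_normal_pd_normal hyU i), hcross]
    simp only [Fin.sum_univ_two, cons_val_zero, cons_val_one, map_smul, map_sub]
    module

end IsParametrizedSurface

theorem IsTchebyshevCoframe.exists_coordinates {V : Set E2} {F n : E2 → E3}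
    {α : Fin 2 → Fin 2 → E2 → ℝ} {u w : Fin 2 → E2 → E3} (hT : IsTchebyshevCoframe V F n α u w)
    (h : IsParametrizedSurface V F n) (hconv : Convex ℝ V) {x : E2} (hx : x ∈ V) :
    ∃ φ : OpenPartialHomeomorph E2 E2, x ∈ φ.source ∧
      ContDiffOn ℝ ∞ φ φ.source ∧ ContDiffOn ℝ ∞ φ.symm φ.target ∧
      ∀ y ∈ φ.target, ∀ a, ⟪pd a (n ∘ φ.symm) y, pd a (F ∘ φ.symm) y⟫ = 0 ∧
        ‖pd a (F ∘ φ.symm) y‖ = 1 := by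
  obtain ⟨Φ, hΦ, hpdΦ⟩ := IsClosedForm.exists_potential_map hT.isClosedForm h.isOpen hconv
  have hdF : ∀ y ∈ V, ∀ i, pd i F y = ∑ a, pd i Φ y a • u a y := fun y hy i => by
    simp only [hT.pd_map y hy i, hpdΦ y hy]
  have hdn : ∀ y ∈ V, ∀ i, pd i n y = ∑ a, pd i Φ y a • w a y := fun y hy i => by
    simp only [hT.pd_normal y hy i, hpdΦ y hy]
  have hinj : ∀ y ∈ V, Function.Injective (fderiv ℝ Φ y) := fun y hy => by
    have hF := h.injective y hy
    rw [fderiv_eq_comp_of_pd_eq_sum (hdF y hy), ContinuousLinearMap.coe_comp] at hF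
    exact hF.of_comp
  obtain ⟨φ, hxφ, hφV, rfl, hφ'⟩ :=
    exists_openPartialHomeomorph_of_injective_fderiv (by simp) h.isOpen hΦ hinj hx
  refine ⟨φ, hxφ, hΦ.mono hφV, hφ', fun y hy a => ?_⟩
  have hyV := hφV (φ.map_target hy)
  have hdφ := differentiableAt_of_contDiffOn h.isOpen hΦ hyV
  have hdφ' := differentiableAt_of_contDiffOn φ.open_target hφ' hy
  rw [pd_comp_symm_eq_of_pd_eq_sum hy hdφ hdφ'
      (differentiableAt_of_contDiffOn h.isOpen h.smooth_normal hyV) (hdn _ hyV),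
    pd_comp_symm_eq_of_pd_eq_sum hy hdφ hdφ'
      (differentiableAt_of_contDiffOn h.isOpen h.smooth_map hyV) (hdF _ hyV)]
  exact ⟨hT.inner_eq_zero _ hyV a, hT.norm_eq_one _ hyV a⟩

theorem IsParametrizedSurface.exists_tchebyshev_coordinates {U : Set E2} {F n : E2 → E3} {x : E2}
    (h : IsParametrizedSurface U F n) {c : ℝ} (hc : c < 0) (hK : ∀ y ∈ U, curvature F n y = c)
    (hx : x ∈ U) :
    ∃ φ : OpenPartialHomeomorph E2 E2, x ∈ φ.source ∧
      ContDiffOn ℝ ∞ φ φ.source ∧ ContDiffOn ℝ ∞ φ.symm φ.target ∧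
      ∀ y ∈ φ.target, ∀ a, ⟪pd a (n ∘ φ.symm) y, pd a (F ∘ φ.symm) y⟫ = 0 ∧
        ‖pd a (F ∘ φ.symm) y‖ = 1 := by
  have hr : ∀ y ∈ U, (√(-c))⁻¹ ^ 2 * curvature F n y = -1 := fun y hy => by
    rw [hK y hy, inv_pow, Real.sq_sqrt (neg_nonneg.2 hc.le), inv_neg, neg_mul,
      inv_mul_cancel₀ hc.ne]
  obtain ⟨V, hVU, hV, hconv, hxV, α, u, w, hT⟩ := h.exists_isTchebyshevCoframe hr hx
  exact hT.exists_coordinates (h.mono hV hVU) hconv hxV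

/-! ### Surfaces read in charts -/

theorem exists_forall_eq_of_pd_comp_symm_eq_zero {M H : Type*} [TopologicalSpace M]
    [PreconnectedSpace M] [NormedAddCommGroup H] [NormedSpace ℝ H] {g : M → H}
    (h : ∀ p, ∃ e : OpenPartialHomeomorph M E2, p ∈ e.source ∧
      DifferentiableOn ℝ (g ∘ e.symm) e.target ∧ ∀ x ∈ e.target, ∀ l, pd l (g ∘ e.symm) x = 0) :
    ∃ c, ∀ p, g p = c := by
  have hloc : IsLocallyConstant g := by
    refine (IsLocallyConstant.iff_exists_open g).2 fun p => ?_
    obtain ⟨e, hp, hd, h0⟩ := h p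
    refine ⟨e.source ∩ e ⁻¹' (e.target ∩ (g ∘ e.symm) ⁻¹' {g p}),
      e.isOpen_inter_preimage (e.open_target.isOpen_inter_preimage_of_fderiv_eq_zero hd
        (fun x hx => clm_ext (h0 x hx)) _), ⟨hp, e.map_source hp, by simp [e.left_inv hp]⟩, ?_⟩
    rintro q ⟨hq, -, hgq⟩
    exact (congrArg g (e.left_inv hq)).symm.trans hgq
  rcases isEmpty_or_nonempty M with hM | ⟨⟨p⟩⟩
  · exact ⟨0, hM.elim⟩
  · exact ⟨g p, fun q => hloc.apply_eq_of_preconnectedSpace q p⟩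

section Charts

variable {M : Type*} [TopologicalSpace M] [ChartedSpace E2 M]
  {e : OpenPartialHomeomorph M E2} {x : E2}

section

variable (he : e ∈ IsManifold.maximalAtlas (𝓡 2) ∞ M)
include he

theorem mdifferentiableAt_chart_symm (hx : x ∈ e.target) :
    MDifferentiableAt 𝓘(ℝ, E2) (𝓡 2) e.symm x :=
  (contMDiffAt_symm_of_mem_maximalAtlas he hx).mdifferentiableAt (by simp)

theorem mfderiv_chart_symm_injective (hx : x ∈ e.target) :
    Function.Injective (mfderiv 𝓘(ℝ, E2) (𝓡 2) e.symm x) := by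
  have he' : MDifferentiableAt (𝓡 2) 𝓘(ℝ, E2) e (e.symm x) :=
    (contMDiffAt_of_mem_maximalAtlas he (e.map_target hx)).mdifferentiableAt (by simp)
  have hcomp := mfderiv_comp x he' (mdifferentiableAt_chart_symm he hx)
  have hinv : e ∘ e.symm =ᶠ[nhds x] id := e.eventually_right_inverse hx
  rw [hinv.mfderiv_eq, mfderiv_id] at hcomp
  exact Function.LeftInverse.injective (g := mfderiv (𝓡 2) 𝓘(ℝ, E2) e (e.symm x))
    fun v => (DFunLike.congr_fun hcomp v).symm

theorem contDiffOn_comp_chart_symm {g : M → E3} (hg : ContMDiff (𝓡 2) 𝓘(ℝ, E3) ∞ g) :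
    ContDiffOn ℝ ∞ (g ∘ e.symm) e.target := by
  rw [← contMDiffOn_iff_contDiffOn]
  exact hg.comp_contMDiffOn (contMDiffOn_symm_of_mem_maximalAtlas he)

theorem fderiv_comp_chart_symm {g : M → E3} (hg : ContMDiff (𝓡 2) 𝓘(ℝ, E3) ∞ g)
    (hx : x ∈ e.target) (v : E2) :
    fderiv ℝ (g ∘ e.symm) x v
      = diffAt g (e.symm x) (mfderiv 𝓘(ℝ, E2) (𝓡 2) e.symm x v) := by
  rw [← mfderiv_eq_fderiv, mfderiv_comp x ((hg _).mdifferentiableAt (by simp))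
    (mdifferentiableAt_chart_symm he hx)]
  rfl

theorem trans_mem_maximalAtlas [IsManifold (𝓡 2) ∞ M] {φ : OpenPartialHomeomorph E2 E2}
    (hφ : ContDiffOn ℝ ∞ φ φ.source) (hφ' : ContDiffOn ℝ ∞ φ.symm φ.target) :
    e.trans φ ∈ IsManifold.maximalAtlas (𝓡 2) ∞ M := by
  refine OpenPartialHomeomorph.mem_maximalAtlas_of_contMDiffOn _ ?_ ?_
  · exact (contMDiffOn_iff_contDiffOn.2 hφ).comp
      ((contMDiffOn_of_mem_maximalAtlas he).mono fun p hp => hp.1) fun p hp => hp.2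
  · exact (contMDiffOn_symm_of_mem_maximalAtlas he).comp
      ((contMDiffOn_iff_contDiffOn.2 hφ').mono fun y hy => hy.1) fun y hy => hy.2

end

variable {f : M → E3} {N : M → S2}

theorem isParametrizedSurface_chart (hf : IsSmoothImmersion f) (hN : IsGaussMap f N)
    (he : e ∈ IsManifold.maximalAtlas (𝓡 2) ∞ M) :
    IsParametrizedSurface e.target (f ∘ e.symm) (toE3 N ∘ e.symm) where
  isOpen := e.open_target
  smooth_map := contDiffOn_comp_chart_symm he hf.smooth
  smooth_normal := contDiffOn_comp_chart_symm he hN.smooth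
  injective x hx v w hvw := by
    rw [fderiv_comp_chart_symm he hf.smooth hx, fderiv_comp_chart_symm he hf.smooth hx] at hvw
    exact mfderiv_chart_symm_injective he hx (hf.injective _ hvw)
  norm_normal _ _ := norm_eq_of_mem_sphere _
  inner_normal_pd_map x hx i := by
    rw [pd, fderiv_comp_chart_symm he hf.smooth hx]
    exact hN.normal _ _

theorem secondFormMatrix_chart (hf : IsSmoothImmersion f) (hN : IsGaussMap f N)
    (he : e ∈ IsManifold.maximalAtlas (𝓡 2) ∞ M) (hx : x ∈ e.target) :
    secondFormMatrix (f ∘ e.symm) (toE3 N ∘ e.symm) x = coordMatrix (secondForm f N) e x := by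
  ext i j
  rw [secondFormMatrix_apply, pd, pd, fderiv_comp_chart_symm he hf.smooth hx,
    fderiv_comp_chart_symm he hN.smooth hx]
  rfl

theorem cross_diffAt_toE3 (hf : IsSmoothImmersion f) (hN : IsGaussMap f N) (p : M)
    (b : Module.Basis (Fin 2) ℝ (TangentSpace (𝓡 2) p)) :
    cross (diffAt (toE3 N) p (b 0)) (diffAt (toE3 N) p (b 1))
      = gaussCurvature f N p • cross (diffAt f p (b 0)) (diffAt f p (b 1)) := by
  let B := (ContinuousLinearMap.toLinearMap₁₂ cross).compl₁₂
    (diffAt f p).toLinearMap (diffAt f p).toLinearMap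
  have hB : B.IsAlt := fun v => cross_self _
  have hN_eq : ∀ v, diffAt (toE3 N) p v = -diffAt f p (shapeOperator f N p v) := fun v => by
    rw [diffAt_shapeOperator hf hN, neg_neg]
  rw [hN_eq, hN_eq, map_neg, map_neg, _root_.neg_apply, neg_neg]
  exact apply_map_map_of_isAlt hB b (shapeOperator f N p)

theorem curvature_chart (hf : IsSmoothImmersion f) (hN : IsGaussMap f N)
    (he : e ∈ IsManifold.maximalAtlas (𝓡 2) ∞ M) (hx : x ∈ e.target) :
    curvature (f ∘ e.symm) (toE3 N ∘ e.symm) x = gaussCurvature f N (e.symm x) := by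
  have hS := isParametrizedSurface_chart hf hN he
  let L : E2 →ₗ[ℝ] E2 := (mfderiv 𝓘(ℝ, E2) (𝓡 2) e.symm x).toLinearMap
  let b := (EuclideanSpace.basisFun (Fin 2) ℝ).toBasis.map
    (LinearEquiv.ofInjectiveEndo L (mfderiv_chart_symm_injective he hx))
  have hpd : ∀ {g : M → E3} (_ : ContMDiff (𝓡 2) 𝓘(ℝ, E3) ∞ g) (i : Fin 2),
      pd i (g ∘ e.symm) x = diffAt g (e.symm x) (b i) := fun hg i => by
    rw [pd, fderiv_comp_chart_symm he hg hx, Module.Basis.map_apply, OrthonormalBasis.coe_toBasis,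
      EuclideanSpace.basisFun_apply]
    rfl
  have hcross : cross (pd 0 (toE3 N ∘ e.symm) x) (pd 1 (toE3 N ∘ e.symm) x)
      = gaussCurvature f N (e.symm x) • cross (pd 0 (f ∘ e.symm) x) (pd 1 (f ∘ e.symm) x) := by
    rw [hpd hN.smooth, hpd hN.smooth, hpd hf.smooth, hpd hf.smooth]
    exact cross_diffAt_toE3 hf hN (e.symm x) b
  rw [curvature, div_eq_iff (hS.areaDensity_map_ne_zero hx), areaDensity, areaDensity, hcross,
    real_inner_smul_right]

theorem tension_eq_zero_iff (hf : IsSmoothImmersion f) (hN : IsGaussMap f N)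
    (he : e ∈ IsManifold.maximalAtlas (𝓡 2) ∞ M) (hx : x ∈ e.target)
    (hK : gaussCurvature f N (e.symm x) ≠ 0) :
    tension (secondForm f N) N e x = 0 ↔ ∀ l, pd l (gaussCurvature f N ∘ e.symm) x = 0 := by
  have hmatrix : coordMatrix (secondForm f N) e
      =ᶠ[nhds x] secondFormMatrix (f ∘ e.symm) (toE3 N ∘ e.symm) :=
    (e.open_target.eventually_mem hx).mono fun y hy => (secondFormMatrix_chart hf hN he hy).symm
  have hcurv : ∀ l, pd l (gaussCurvature f N ∘ e.symm) x
      = pd l (curvature (f ∘ e.symm) (toE3 N ∘ e.symm)) x :=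
    pd_congr_of_eqOn e.open_target (fun y hy => (curvature_chart hf hN he hy).symm) hx
  rw [tension, traceHessian_congr hmatrix]
  simp only [hcurv]
  exact (isParametrizedSurface_chart hf hN he).tangentialPart_traceHessian_eq_zero_iff hx
    (by rwa [curvature_chart hf hN he hx])

theorem pd_gaussCurvature_eq_zero (hf : IsSmoothImmersion f) (hN : IsGaussMap f N)
    (he : e ∈ IsManifold.maximalAtlas (𝓡 2) ∞ M) (hT : IsTchebyshev f N e) (hx : x ∈ e.target)
    (l : Fin 2) : pd l (gaussCurvature f N ∘ e.symm) x = 0 := by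
  have hcurv : pd l (gaussCurvature f N ∘ e.symm) x
      = pd l (curvature (f ∘ e.symm) (toE3 N ∘ e.symm)) x :=
    pd_congr_of_eqOn e.open_target (fun y hy => (curvature_chart hf hN he hy).symm) hx l
  exact hcurv.trans ((isParametrizedSurface_chart hf hN he).pd_curvature_eq_zero hT.1 hT.2 hx l)

theorem exists_forall_gaussCurvature_eq [PreconnectedSpace M] (hf : IsSmoothImmersion f)
    (hN : IsGaussMap f N)
    (h : ∀ p : M, ∃ e ∈ IsManifold.maximalAtlas (𝓡 2) ∞ M, p ∈ e.source ∧
      ∀ x ∈ e.target, ∀ l, pd l (gaussCurvature f N ∘ e.symm) x = 0) :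
    ∃ c : ℝ, ∀ p, gaussCurvature f N p = c := by
  refine exists_forall_eq_of_pd_comp_symm_eq_zero fun p => ?_
  obtain ⟨e, he, hp, h0⟩ := h p
  exact ⟨e, hp, ((isParametrizedSurface_chart hf hN he).contDiffOn_curvature.differentiableOn
    (by simp)).congr fun x hx => (curvature_chart hf hN he hx).symm, h0⟩

theorem exists_isTchebyshev [IsManifold (𝓡 2) ∞ M] (hf : IsSmoothImmersion f)
    (hN : IsGaussMap f N) {c : ℝ} (hc : c < 0) (hK : ∀ p, gaussCurvature f N p = c) (p : M) :
    ∃ e ∈ IsManifold.maximalAtlas (𝓡 2) ∞ M, p ∈ e.source ∧ IsTchebyshev f N e := by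
  have he := IsManifold.chart_mem_maximalAtlas (I := 𝓡 2) (n := ∞) p
  have hp := mem_chart_source E2 p
  obtain ⟨φ, hpφ, hφ, hφ', hT⟩ :=
    (isParametrizedSurface_chart hf hN he).exists_tchebyshev_coordinates hc
      (fun x hx => (curvature_chart hf hN he hx).trans (hK _)) ((chartAt E2 p).map_source hp)
  exact ⟨(chartAt E2 p).trans φ, trans_mem_maximalAtlas he hφ hφ', ⟨hp, hpφ⟩,
    fun y hy i => (hT y hy.1 i).1, fun y hy i => (hT y hy.1 i).2⟩

end Charts

end KSurface

end

theorem mainTheorem1 {M : Type*} [TopologicalSpace M] [ChartedSpace KSurface.E2 M]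
    [IsManifold (𝓡 2) ∞ M] [PreconnectedSpace M]
    (f : M → KSurface.E3) (N : M → KSurface.S2)
    (hf : KSurface.IsSmoothImmersion f) (hN : KSurface.IsGaussMap f N)
    (hK : ∀ p, KSurface.gaussCurvature f N p < 0) :
    List.TFAE [
      ∃ c : ℝ, ∀ p, KSurface.gaussCurvature f N p = c,
      KSurface.IsHarmonic (KSurface.secondForm f N) N,
      ∀ p : M, ∃ e ∈ IsManifold.maximalAtlas (𝓡 2) ∞ M,
        p ∈ e.source ∧ KSurface.IsTchebyshev f N e] := by
  tfae_have 1 → 2 := by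
    rintro ⟨c, hc⟩ e he x hx
    rw [KSurface.tension_eq_zero_iff hf hN he hx (hK _).ne, funext hc]
    exact fun l => KSurface.pd_const c l x
  tfae_have 2 → 1 := fun hharm =>
    KSurface.exists_forall_gaussCurvature_eq hf hN fun p =>
      have he := IsManifold.chart_mem_maximalAtlas p
      ⟨chartAt KSurface.E2 p, he, mem_chart_source _ p, fun x hx =>
        (KSurface.tension_eq_zero_iff hf hN he hx (hK _).ne).1 (hharm _ he x hx)⟩
  tfae_have 1 → 3 := fun ⟨c, hc⟩ p =>
    KSurface.exists_isTchebyshev hf hN (hc p ▸ hK p) hc p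
  tfae_have 3 → 1 := fun hT =>
    KSurface.exists_forall_gaussCurvature_eq hf hN fun p =>
      have ⟨e, he, hp, hTe⟩ := hT p
      ⟨e, he, hp, fun _ hx => KSurface.pd_gaussCurvature_eq_zero hf hN he hTe hx⟩
  tfae_finish
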